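/- **Setting.** Fix $N$ nodes, a target level $\alpha\in(0,1)$, local null proportions $r_0^{(i)}\in[0,1)$ not depending on $m$, and a distribution function $F$ of a probability law on $[0,1]$ (the common law of the p-values under the alternative). Let $q_m=(q_m^{(1)},\dots,q_m^{(N)})$ be probability vectors with $q_m^{(i)}\to q^{(i)}$ as $m\to\infty$ and $\sum_{m}q_m^{(i)}=\infty$ for every $i$. For each $m$ the network holds $m$ independent p-values $P_1,\dots,P_m$. Each of them is generated in node $i$ with probability $q_s^{(i)}$; given node $i$, its null hypothesis is true with probability $r_0^{(i)}$; it is uniform on $[0,1]$ under the null and has distribution function $F$ under the alternative. Here either $s=m$ for all $m$ p-values (they are i.i.d. with distribution function $\sum_i q_m^{(i)}\big(r_0^{(i)}t+(1-r_0^{(i)})F(t)\big)$), or $s=k$ for the $k$-th p-value (the p-values are generated one after another); the result holds in both cases. Let $m^{(i)}$ be the number of p-values in node $i$. **Procedures.** BH at level $a$ applied to p-values $p_1,\dots,p_n$, with order statistics $p_{(1)}\le\dots\le p_{(n)}$ and $p_{(0)}=0$, rejects the hypotheses whose p-values are at most $a\hat k/n$, where $\hat k=\max\{0\le k\le n:\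 p_{(k)}\le ak/n\}$. The *global BH* applies BH at level $\alpha$ to all $m$ p-values. In the *distributed BH method*, given estimators $\hat r_0^{(i)}\in[0,1]$ of $r_0^{(i)}$, one computes $$\hat r_0^*=\frac1m\sum_{i=1}^N\hat r_0^{(i)}m^{(i)},\qquad \hat\beta^*=\frac{1/\alpha-\hat r_0^*}{1-\hat r_0^*},\qquad \hat\alpha^{(i)}=\frac1{(1-\hat r_0^{(i)})\hat\beta^*+\hat r_0^{(i)}},$$ and each node $i$ applies BH at level $\hat\alpha^{(i)}$ to its own p-values; the rejections of all nodes are collected. If a procedure makes $R$ rejections in the whole network, $V$ of them of true nulls, and $m_1$ is the number of true alternatives, then $$\mathrm{FDR}=\mathbb E\Big[\frac{V}{\max\{R,1\}}\Big],\qquad \mathrm{power}=\mathbb E\Big[\frac{R-V}{\max\{m_1,1\}}\Big].$$ **Proposition.** Assume that the estimators are strongly consistent: for every $i$, almost surely, $\hat r_0^{(i)}\to r_0^{(i)}$ whenever $m^{(i)}\to\infty$. Put $$r_0^*=\sum_{i=1}^N q^{(i)}r_0^{(i)},\qquad \beta^*=\frac{1/\alpha-r_0^*}{1-r_0^*},\qquad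 \tau^*=\sup\{t: F(t)=\beta^*t\},$$ and assume that $F$ is continuously differentiable at $\tau^*$ (differentiable near $\tau^*$, with $F'$ continuous at $\tau^*$), that $F'(\tau^*)\ne\beta^*$, and that $\tau^*>0$. Then, as $m\to\infty$, the FDR of the distributed BH method and the FDR of the global BH converge to the same limit, and the power of the distributed BH method and the power of the global BH converge to the same limit. -/

import Mathlib

open MeasureTheory ProbabilityTheory Filter Topology

noncomputable section

namespace DistributedBH

/-! ### The Benjamini-Hochberg procedure -/

/-- The order statistic `p_(k)` of the values `p j`, `j ∈ S` (sorted increasingly), for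
`1 ≤ k ≤ #S`, with the convention `p_(0) = 0`. -/
def orderStat {m : ℕ} (p : Fin m → ℝ) (S : Finset (Fin m)) (k : ℕ) : ℝ :=
  if k = 0 then 0 else ((S.val.map p).sort (· ≤ ·)).getD (k - 1) 0

/-- The index `k̂ = max {0 ≤ k ≤ n : p_(k) ≤ a k / n}` of BH with test size `a` applied to the
`n = #S` p-values `p j`, `j ∈ S`. The index `k = 0` always qualifies. -/
def bhIndex {m : ℕ} (p : Fin m → ℝ) (S : Finset (Fin m)) (a : ℝ) : ℕ :=
  ((Finset.range (S.card + 1)).filter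
    (fun k => orderStat p S k ≤ a * (k : ℝ) / (S.card : ℝ))).sup id

/-- The BH rejection threshold `a k̂ / n`. -/
def bhThreshold {m : ℕ} (p : Fin m → ℝ) (S : Finset (Fin m)) (a : ℝ) : ℝ :=
  a * (bhIndex p S a : ℝ) / (S.card : ℝ)

/-- The set of hypotheses in `S` rejected by BH with test size `a`: those whose p-value is at
most the BH threshold. -/
def bhReject {m : ℕ} (p : Fin m → ℝ) (S : Finset (Fin m)) (a : ℝ) : Finset (Fin m) :=
  S.filter (fun j => p j ≤ bhThreshold p S a)

/-! ### False discovery proportion and true discovery proportion -/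

/-- `FDP = V / max {R, 1}` of the rejection set `A`; `null j = true` means that the `j`-th null
hypothesis is true. -/
def fdp {m : ℕ} (null : Fin m → Bool) (A : Finset (Fin m)) : ℝ :=
  ((A.filter (fun j => null j = true)).card : ℝ) / max (A.card : ℝ) 1

/-- `TDP = (R - V) / max {m₁, 1}` of the rejection set `A`, where `m₁` is the total number of true
alternatives. -/
def tdp {m : ℕ} (null : Fin m → Bool) (A : Finset (Fin m)) : ℝ :=
  ((A.card : ℝ) - ((A.filter (fun j => null j = true)).card : ℝ)) /
    max ((Finset.univ.filter (fun j => null j = false)).card : ℝ) 1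

/-! ### The distributed BH method -/

/-- The slope `β(α; r₀) = (1/α - r₀) / (1 - r₀)`. -/
def slope (α r₀ : ℝ) : ℝ := (1 / α - r₀) / (1 - r₀)

/-- The indices of the p-values owned by node `i`. -/
def nodeSet {N m : ℕ} (node : Fin m → Fin N) (i : Fin N) : Finset (Fin m) :=
  Finset.univ.filter (fun k => node k = i)

/-- The estimated global null proportion `r̂₀* = (1/m) ∑ i, r̂₀⁽ⁱ⁾ m⁽ⁱ⁾`. -/
def globalNullEstimate {N m : ℕ} (node : Fin m → Fin N) (rhat : Fin N → ℝ) : ℝ :=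
  (1 / (m : ℝ)) * ∑ i, rhat i * ((nodeSet node i).card : ℝ)

/-- The broadcast parameter `β̂* = (1/α - r̂₀*) / (1 - r̂₀*)`. -/
def slopeEstimate {N m : ℕ} (α : ℝ) (node : Fin m → Fin N) (rhat : Fin N → ℝ) : ℝ :=
  slope α (globalNullEstimate node rhat)

/-- The plug-in test size `α̂⁽ⁱ⁾ = 1 / ((1 - r̂₀⁽ⁱ⁾) β̂* + r̂₀⁽ⁱ⁾)` of node `i`. -/
def localLevel {N m : ℕ} (α : ℝ) (node : Fin m → Fin N) (rhat : Fin N → ℝ) (i : Fin N) : ℝ :=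
  1 / ((1 - rhat i) * slopeEstimate α node rhat + rhat i)

/-- Rejections of the global (pooled) BH procedure at level `α`. -/
def globalReject {m : ℕ} (α : ℝ) (p : Fin m → ℝ) : Finset (Fin m) :=
  bhReject p Finset.univ α

/-- Rejections of the distributed BH method: every node runs BH on its own p-values with its
plug-in test size. -/
def distReject {N m : ℕ} (α : ℝ) (node : Fin m → Fin N) (rhat : Fin N → ℝ) (p : Fin m → ℝ) :
    Finset (Fin m) :=
  Finset.univ.biUnion (fun i => bhReject p (nodeSet node i) (localLevel α node rhat i))

/-! ### The mixture model -/

/-- The uniform law on `[0, 1]`. -/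
def unif01 : Measure ℝ := volume.restrict (Set.Icc 0 1)

/-- The joint law of (node, truth of the null hypothesis, p-value) for a single p-value: node `i`
is chosen with probability `q i`; given node `i`, the null hypothesis is true with probability
`r₀ i`; the p-value is uniform under the null and has law `ν` under the alternative. -/
def entryLaw {N : ℕ} (q r₀ : Fin N → ℝ) (ν : Measure ℝ) : Measure (Fin N × Bool × ℝ) :=
  ∑ i, ENNReal.ofReal (q i) • (Measure.dirac i).prod
    (ENNReal.ofReal (r₀ i) • (Measure.dirac true).prod unif01 +
      ENNReal.ofReal (1 - r₀ i) • (Measure.dirac false).prod ν)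

/-- The two ways in which the node probabilities `q_m` may enter. In the `array` scheme all `m`
p-values of the network of size `m` use the node probabilities `q_m` (so they are i.i.d. with
distribution function `∑ i, q_m⁽ⁱ⁾ G(t; r₀⁽ⁱ⁾)`); in the `sequential` scheme the p-values arrive one
after another and the `k`-th one uses `q_k`. -/
inductive Scheme
  | array
  | sequential

/-- The index `s` for which `q_s` governs the node of the p-value with (zero-based) number `k` in
the network with `m` p-values. -/
def Scheme.index : Scheme → ℕ → ℕ → ℕ
  | Scheme.array, m, _ => m
  | Scheme.sequential, _, k => k + 1

/-- For every `m`, the network with `m` p-values consists of `m` independent triples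
(node, truth of the null hypothesis, p-value) from the mixture model. Nothing is required of the
joint law for different `m`; in particular the network may grow by appending p-values. -/
structure IsNetworkSample {N : ℕ} {Ω : Type*} [MeasurableSpace Ω] (μ : Measure Ω)
    (scheme : Scheme) (q : ℕ → Fin N → ℝ) (r₀ : Fin N → ℝ) (ν : Measure ℝ)
    (node : (m : ℕ) → Ω → Fin m → Fin N) (null : (m : ℕ) → Ω → Fin m → Bool)
    (p : (m : ℕ) → Ω → Fin m → ℝ) : Prop where
  measurable_node : ∀ m, ∀ k : Fin m, Measurable (fun ω => node m ω k)
  measurable_null : ∀ m, ∀ k : Fin m, Measurable (fun ω => null m ω k)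
  measurable_p : ∀ m, ∀ k : Fin m, Measurable (fun ω => p m ω k)
  law : ∀ m, ∀ k : Fin m, μ.map (fun ω => (node m ω k, null m ω k, p m ω k)) =
    entryLaw (q (scheme.index m k)) r₀ ν
  indep : ∀ m, iIndepFun (fun (k : Fin m) ω => (node m ω k, null m ω k, p m ω k)) μ

/-- `τ = sup {t : F(t) = β t}`. -/
def lastCrossing (F : ℝ → ℝ) (β : ℝ) : ℝ := sSup {t : ℝ | F t = β * t}

/-- `F` is continuously differentiable at `t`: it is differentiable in a neighbourhood of `t` and
its derivative is continuous at `t`. -/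
def ContinuouslyDifferentiableAt (F : ℝ → ℝ) (t : ℝ) : Prop :=
  (∀ᶠ s in 𝓝 t, DifferentiableAt ℝ F s) ∧ ContinuousAt (deriv F) t

end DistributedBH

end

namespace DistributedBH

/-! The plug-in levels align the crossing points of all nodes. BH at level `a` finds, in the limit,
the last point where the distribution function `G` of the p-values meets the line of slope `1 / a`.
In a node with null proportion `r`, `G(t) = r t + (1 - r) F(t)` on `[0, 1]`, and the limiting level
satisfies `1 / a = (1 - r) β + r`; the terms `r t` cancel and the crossing equation becomes `F(t) =
β t`, whatever `r` is. The pooled sample is the same case with `r = ∑ i, q i * r₀ i`, because then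
`1 / a = 1 / α`. Hence the global threshold and all local thresholds in nodes of positive limiting
weight tend to the same `τ`.

The probability is confined to one almost sure event (`ae_isRegular`): all proportions of p-values
by node, truth value and rational cutoff converge. On that event the argument is deterministic. The
conditions at `τ` make the crossing transversal (`eventually_lt_cdf_of_deriv_ne`), so the thresholds
converge (`tendsto_bhThreshold`). Since `F` is continuous at `τ`, the counts below these thresholds
have the same limits for both methods (`tendsto_cellCount_threshold`); nodes of limiting weight zero
contribute nothing. The limiting proportion of rejections is positive, so the bounded ratios FDP and
TDP converge almost surely, and dominated convergence gives FDR and power. -/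

/-! ### BH in terms of counts instead of order statistics. -/

theorem getElem_le_iff_lt_countP {l : List ℝ} (hl : l.Pairwise (· ≤ ·)) (x : ℝ) (i : ℕ)
    (hi : i < l.length) : l[i] ≤ x ↔ i < l.countP (fun y => decide (y ≤ x)) := by
  induction l generalizing i with
  | nil => simp at hi
  | cons a l ih =>
    rw [List.pairwise_cons] at hl
    by_cases ha : a ≤ x
    · cases i with
      | zero => simp [ha]
      | succ i =>
        have := ih hl.2 i (by simpa using hi)
        simpa [List.countP_cons, ha] using this
    · have h0 : (a :: l).countP (fun y => decide (y ≤ x)) = 0 := by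
        rw [List.countP_eq_zero]
        intro b hb
        rcases List.mem_cons.1 hb with rfl | hb
        · simpa using ha
        · simpa using (not_le.1 ha).trans_le (hl.1 b hb)
      rw [h0]
      simp only [not_lt_zero, iff_false, not_le]
      cases i with
      | zero => simpa using ha
      | succ i => exact (not_le.1 ha).trans_le (hl.1 _ (by simp))

/-- The number of indices in `S` whose value is at most `t`. -/
noncomputable def countLE {m : ℕ} (p : Fin m → ℝ) (S : Finset (Fin m)) (t : ℝ) : ℕ :=
  (S.filter (fun j => p j ≤ t)).card

theorem countLE_mono {m : ℕ} (p : Fin m → ℝ) (S : Finset (Fin m)) : Monotone (countLE p S) :=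
  fun _ _ h => Finset.card_le_card
    (Finset.monotone_filter_right _ fun _ _ hj => le_trans hj h)

theorem countLE_le_card {m : ℕ} (p : Fin m → ℝ) (S : Finset (Fin m)) (t : ℝ) :
    countLE p S t ≤ S.card := Finset.card_filter_le _ _

/-- In a sorted list the entries at most `x` form an initial segment, so its length decides the
comparison. -/
theorem orderStat_le_iff {m : ℕ} (p : Fin m → ℝ) (S : Finset (Fin m)) (k : ℕ) (hk : k ≠ 0)
    (hkS : k ≤ S.card) (x : ℝ) : orderStat p S k ≤ x ↔ k ≤ countLE p S x := by
  have hlen : ((S.val.map p).sort (· ≤ ·)).length = S.card := by simp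
  have hi : k - 1 < ((S.val.map p).sort (· ≤ ·)).length := by omega
  have hcount : ((S.val.map p).sort (· ≤ ·)).countP (fun y => decide (y ≤ x)) =
      countLE p S x := by
    rw [← Multiset.coe_countP (p := fun y => y ≤ x), Multiset.sort_eq, Multiset.countP_map]
    rfl
  rw [orderStat, if_neg hk, List.getD_eq_getElem _ _ hi,
    getElem_le_iff_lt_countP (Multiset.pairwise_sort _ _), hcount]
  omega

/-- The range restriction is absorbed because `countLE` never exceeds `S.card`; `k = 0` satisfies
both sides. -/
theorem mem_filter_orderStat_iff {m : ℕ} (p : Fin m → ℝ) (S : Finset (Fin m)) (a : ℝ) (k : ℕ) :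
    k ∈ (Finset.range (S.card + 1)).filter
      (fun k => orderStat p S k ≤ a * (k : ℝ) / (S.card : ℝ)) ↔
    k ≤ countLE p S (a * (k : ℝ) / (S.card : ℝ)) := by
  rw [Finset.mem_filter, Finset.mem_range]
  rcases eq_or_ne k 0 with rfl | hk
  · simp [orderStat]
  constructor
  · rintro ⟨h1, h2⟩
    exact (orderStat_le_iff p S k hk (by omega) _).1 h2
  · intro h
    have := h.trans (countLE_le_card p S _)
    exact ⟨by omega, (orderStat_le_iff p S k hk this _).2 h⟩

theorem bhIndex_le_countLE {m : ℕ} (p : Fin m → ℝ) (S : Finset (Fin m)) (a : ℝ) :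
    bhIndex p S a ≤ countLE p S (bhThreshold p S a) := by
  have hne : ((Finset.range (S.card + 1)).filter
      (fun k => orderStat p S k ≤ a * (k : ℝ) / (S.card : ℝ))).Nonempty :=
    ⟨0, (mem_filter_orderStat_iff p S a 0).2 (Nat.zero_le _)⟩
  obtain ⟨k, hk, hke⟩ := Finset.exists_mem_eq_sup _ hne id
  have h := (mem_filter_orderStat_iff p S a k).1 hk
  have hk' : bhIndex p S a = k := hke
  rw [bhThreshold, hk']
  exact h

theorem le_bhIndex {m : ℕ} (p : Fin m → ℝ) (S : Finset (Fin m)) (a : ℝ) {k : ℕ}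
    (hk : k ≤ countLE p S (a * (k : ℝ) / (S.card : ℝ))) : k ≤ bhIndex p S a :=
  Finset.le_sup (f := id) ((mem_filter_orderStat_iff p S a k).2 hk)

/-- With `lt_bhThreshold`, this is all that the limit argument needs: the threshold lies weakly
under `a` times the empirical distribution function, and every point strictly under it is below the
threshold. -/
theorem bhThreshold_le {m : ℕ} (p : Fin m → ℝ) (S : Finset (Fin m)) {a : ℝ} (ha : 0 ≤ a) :
    bhThreshold p S a ≤ a * ((countLE p S (bhThreshold p S a) : ℝ) / (S.card : ℝ)) := by
  rw [← mul_div_assoc]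
  conv_lhs => rw [bhThreshold]
  have := bhIndex_le_countLE p S a
  gcongr

/-- With `k = countLE p S t`, the candidate `a k / n` exceeds `t`, so at least `k` values lie below
it and `k` qualifies as an index. -/
theorem lt_bhThreshold {m : ℕ} (p : Fin m → ℝ) (S : Finset (Fin m)) {a t : ℝ} (ha : 0 ≤ a)
    (ht : t < a * ((countLE p S t : ℝ) / (S.card : ℝ))) : t < bhThreshold p S a := by
  rw [← mul_div_assoc] at ht
  refine ht.trans_le ?_
  have : countLE p S t ≤ bhIndex p S a := le_bhIndex p S a (countLE_mono p S ht.le)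
  rw [bhThreshold]
  gcongr

/-- Replacing the maximum by a finite existential over `k` turns rejection into a finite union of
measurable events. -/
theorem mem_bhReject_iff {m : ℕ} (p : Fin m → ℝ) (S : Finset (Fin m)) {a : ℝ} (ha : 0 ≤ a)
    (j : Fin m) : j ∈ bhReject p S a ↔ j ∈ S ∧ ∃ k ∈ Finset.range (m + 1),
      k ≤ countLE p S (a * (k : ℝ) / (S.card : ℝ)) ∧ p j ≤ a * (k : ℝ) / (S.card : ℝ) := by
  rw [bhReject, Finset.mem_filter]
  refine and_congr_right fun _ => ⟨fun h => ⟨bhIndex p S a, ?_, bhIndex_le_countLE p S a, h⟩, ?_⟩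
  · have h1 := (bhIndex_le_countLE p S a).trans (countLE_le_card p S _)
    have h2 : S.card ≤ m := by simpa using S.card_le_univ
    simp only [Finset.mem_range]
    omega
  · rintro ⟨k, -, hk, hj⟩
    refine hj.trans ?_
    have := le_bhIndex p S a hk
    rw [bhThreshold]
    gcongr

/-! ### Deterministic convergence of thresholds and of counts. -/

/-- If the empirical distribution functions converge at rational points to a right-continuous `G`
that crosses the line of slope `1 / a` for the last time, from above, at `τ`, then the BH
thresholds converge to `τ`. -/
theorem tendsto_bhThreshold {p : (m : ℕ) → Fin m → ℝ} {S : (m : ℕ) → Finset (Fin m)}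
    {a : ℕ → ℝ} {a' τ : ℝ} {G : ℝ → ℝ} (ha_nonneg : ∀ m, 0 ≤ a m)
    (ha : Tendsto a atTop (𝓝 a'))
    (hG : ∀ t : ℚ, Tendsto (fun m => (countLE (p m) (S m) t : ℝ) / ((S m).card : ℝ)) atTop
      (𝓝 (G t)))
    (hGc : ∀ t, ContinuousWithinAt G (Set.Ioi t) t)
    (hright : ∀ t, τ < t → a' * G t < t) (hleft : ∀ᶠ t in 𝓝[<] τ, t < a' * G t) :
    Tendsto (fun m => bhThreshold (p m) (S m) (a m)) atTop (𝓝 τ) := by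
  have hle : ∀ m t, (countLE (p m) (S m) t : ℝ) / ((S m).card : ℝ) ≤ 1 := fun m t =>
    div_le_one_of_le₀ (by exact_mod_cast countLE_le_card _ _ _) (by positivity)
  rw [tendsto_order]
  constructor
  · intro b hb
    obtain ⟨c, hc, hcs⟩ := (mem_nhdsLT_iff_exists_Ioo_subset' hb).1 hleft
    obtain ⟨t, ht1, ht2⟩ := exists_rat_btwn (max_lt hb hc)
    have htG : (t : ℝ) < a' * G t := hcs ⟨(le_max_right _ _).trans_lt ht1, ht2⟩
    filter_upwards [(ha.mul (hG t)).eventually (lt_mem_nhds htG)] with m hm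
    exact ((le_max_left _ _).trans_lt ht1).trans (lt_bhThreshold _ _ (ha_nonneg m) hm)
  · intro b hb
    by_contra hcon
    -- A threshold is at most `a m`, which is eventually below `a' + 1`. Thresholds that return
    -- above `b` infinitely often therefore have a cluster point `T > τ`.
    have hfreq : ∃ᶠ m in atTop, bhThreshold (p m) (S m) (a m) ∈ Set.Icc b (a' + 1) := by
      refine (Filter.Frequently.and_eventually (not_eventually.1 hcon)
        (ha.eventually (gt_mem_nhds (lt_add_one a')))).mono ?_
      rintro m ⟨h1, h2⟩
      refine ⟨not_lt.1 h1, (bhThreshold_le _ _ (ha_nonneg m)).trans (le_trans ?_ h2.le)⟩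
      exact mul_le_of_le_one_right (ha_nonneg m) (hle _ _)
    obtain ⟨T, hT, hcl⟩ := isCompact_Icc.exists_mapClusterPt_of_frequently hfreq
    have hτT : τ < T := hb.trans_le hT.1
    -- If `a' * G s < c < T < s`, infinitely many thresholds lie in `(c, s)`; by monotonicity each
    -- is at most `a m` times the empirical distribution function at `s`, which is eventually below
    -- `c`.
    have hkey : ∀ s : ℚ, T < s → T ≤ a' * G s := by
      intro s hs
      by_contra hlt
      push Not at hlt
      obtain ⟨c, hc1, hc2⟩ := exists_between hlt
      have hf := hcl.frequently (Ioo_mem_nhds hc2 hs)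
      obtain ⟨m, hm1, hm2⟩ :=
        (hf.and_eventually ((ha.mul (hG s)).eventually (gt_mem_nhds hc1))).exists
      have h1 := bhThreshold_le (p m) (S m) (ha_nonneg m)
      have h2 : (countLE (p m) (S m) (bhThreshold (p m) (S m) (a m)) : ℝ) / ((S m).card : ℝ) ≤
          (countLE (p m) (S m) s : ℝ) / ((S m).card : ℝ) := by
        gcongr
        exact countLE_mono _ _ hm1.2.le
      have h3 := mul_le_mul_of_nonneg_left h2 (ha_nonneg m)
      linarith [hm1.1]
    -- Right-continuity carries `a' * G T < T` to rational points just right of `T`, against `hkey`.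
    have h1 : ∀ᶠ s in 𝓝[>] T, a' * G s < T :=
      ((hGc T).const_mul a').eventually (gt_mem_nhds (hright T hτT))
    obtain ⟨c, hc, hcs⟩ := mem_nhdsGT_iff_exists_Ioo_subset.1 h1
    obtain ⟨s, hs1, hs2⟩ := exists_rat_btwn (show T < c from hc)
    exact absurd (hkey s hs1) (not_le.2 (hcs ⟨hs1, hs2⟩))

/-- Monotone step functions that converge at rational points may be evaluated along a convergent
sequence, provided the limit is continuous there. -/
theorem tendsto_apply_of_monotone {f : ℕ → ℝ → ℝ} {g : ℝ → ℝ} {T : ℕ → ℝ} {τ : ℝ}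
    (hf : ∀ m, Monotone (f m)) (hfg : ∀ t : ℚ, Tendsto (fun m => f m t) atTop (𝓝 (g t)))
    (hT : Tendsto T atTop (𝓝 τ)) (hg : ContinuousAt g τ) :
    Tendsto (fun m => f m (T m)) atTop (𝓝 (g τ)) := by
  rw [tendsto_order]
  constructor
  · intro b hb
    obtain ⟨l, u, ⟨hl, hu⟩, hsub⟩ :=
      mem_nhds_iff_exists_Ioo_subset.1 (hg.eventually (lt_mem_nhds hb))
    obtain ⟨s, hs1, hs2⟩ := exists_rat_btwn hl
    filter_upwards [(hfg s).eventually (lt_mem_nhds (hsub ⟨hs1, hs2.trans hu⟩)),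
      hT.eventually (lt_mem_nhds hs2)] with m h1 h2
    exact h1.trans_le (hf m h2.le)
  · intro b hb
    obtain ⟨l, u, ⟨hl, hu⟩, hsub⟩ :=
      mem_nhds_iff_exists_Ioo_subset.1 (hg.eventually (gt_mem_nhds hb))
    obtain ⟨s, hs1, hs2⟩ := exists_rat_btwn hu
    filter_upwards [(hfg s).eventually (gt_mem_nhds (hsub ⟨hl.trans hs1, hs2⟩)),
      hT.eventually (gt_mem_nhds hs1)] with m h1 h2
    exact (hf m h2.le).trans_lt h1

/-! ### Measurability and bounds for FDP and TDP, and passage to expectations. -/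

theorem measurable_card_of_mem {Ω : Type*} [MeasurableSpace Ω] {m : ℕ}
    {A : Ω → Finset (Fin m)} (hA : ∀ j, MeasurableSet {ω | j ∈ A ω}) :
    Measurable (fun ω => ((A ω).card : ℝ)) := by
  classical
  have h : (fun ω => ((A ω).card : ℝ)) =
      fun ω => ∑ j, {ω | j ∈ A ω}.indicator (fun _ => (1 : ℝ)) ω := by
    funext ω
    simp [Set.indicator_apply]
  rw [h]
  exact Finset.measurable_fun_sum _ fun j _ => measurable_const.indicator (hA j)

theorem measurableSet_mem_bhReject {Ω : Type*} [MeasurableSpace Ω] {m : ℕ}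
    {P : Ω → Fin m → ℝ} {S : Ω → Finset (Fin m)} {a : Ω → ℝ}
    (hP : ∀ j, Measurable fun ω => P ω j) (hS : ∀ j, MeasurableSet {ω | j ∈ S ω})
    (ha : Measurable a) (ha0 : ∀ ω, 0 ≤ a ω) (j : Fin m) :
    MeasurableSet {ω | j ∈ bhReject (P ω) (S ω) (a ω)} := by
  have hthr : ∀ k : ℕ, Measurable fun ω => a ω * (k : ℝ) / ((S ω).card : ℝ) := fun k =>
    (ha.mul_const _).div (measurable_card_of_mem hS)
  have hset : {ω | j ∈ bhReject (P ω) (S ω) (a ω)} = {ω | j ∈ S ω} ∩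
      ⋃ k ∈ Finset.range (m + 1),
        {ω | (k : ℝ) ≤ (countLE (P ω) (S ω) (a ω * (k : ℝ) / ((S ω).card : ℝ)) : ℝ)} ∩
        {ω | P ω j ≤ a ω * (k : ℝ) / ((S ω).card : ℝ)} := by
    ext ω
    simp only [Set.mem_ofPred_eq, mem_bhReject_iff _ _ (ha0 ω), Set.mem_inter_iff, Set.mem_iUnion,
      Nat.cast_le, exists_prop]
  rw [hset]
  refine (hS j).inter (Finset.measurableSet_biUnion _ fun k _ => ?_)
  refine (measurableSet_le measurable_const ?_).inter (measurableSet_le (hP j) (hthr k))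
  refine measurable_card_of_mem fun l => ?_
  simp only [Finset.mem_filter]
  exact (hS l).inter (measurableSet_le (hP l) (hthr k))

theorem fdp_mem_Icc {m : ℕ} (null : Fin m → Bool) (A : Finset (Fin m)) :
    fdp null A ∈ Set.Icc (0 : ℝ) 1 := by
  rw [fdp]
  refine ⟨by positivity, div_le_one_of_le₀ (le_max_of_le_left ?_) (by positivity)⟩
  exact_mod_cast Finset.card_filter_le _ _

theorem card_filter_null_add {m : ℕ} (null : Fin m → Bool) (A : Finset (Fin m)) :
    (A.filter fun k => null k = true).card + (A.filter fun k => null k = false).card = A.card := by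
  have h := Finset.card_filter_add_card_filter_not (s := A) (fun j => null j = true)
  simpa only [Bool.not_eq_true] using h

theorem card_sub_card_filter_null {m : ℕ} (null : Fin m → Bool) (A : Finset (Fin m)) :
    (A.card : ℝ) - ((A.filter (fun j => null j = true)).card : ℝ) =
      ((A.filter (fun j => null j = false)).card : ℝ) := by
  rw [← card_filter_null_add null A]
  push_cast
  ring

theorem tdp_mem_Icc {m : ℕ} (null : Fin m → Bool) (A : Finset (Fin m)) :
    tdp null A ∈ Set.Icc (0 : ℝ) 1 := by
  rw [tdp, card_sub_card_filter_null]
  refine ⟨by positivity, div_le_one_of_le₀ (le_max_of_le_left ?_) (by positivity)⟩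
  exact_mod_cast Finset.card_le_card (Finset.filter_subset_filter _ (Finset.subset_univ _))

theorem measurableSet_mem_filter {Ω : Type*} [MeasurableSpace Ω] {m : ℕ}
    {A : Ω → Finset (Fin m)} (hA : ∀ j, MeasurableSet {ω | j ∈ A ω}) {null : Ω → Fin m → Bool}
    (hnull : ∀ k, Measurable fun ω => null ω k) (b : Bool) (j : Fin m) :
    MeasurableSet {ω | j ∈ (A ω).filter (fun j => null ω j = b)} := by
  simp only [Finset.mem_filter]
  exact (hA j).inter (hnull j (measurableSet_singleton b))

theorem measurable_fdp {Ω : Type*} [MeasurableSpace Ω] {m : ℕ}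
    {A : Ω → Finset (Fin m)} (hA : ∀ j, MeasurableSet {ω | j ∈ A ω}) {null : Ω → Fin m → Bool}
    (hnull : ∀ k, Measurable fun ω => null ω k) : Measurable fun ω => fdp (null ω) (A ω) :=
  (measurable_card_of_mem (measurableSet_mem_filter hA hnull true)).div
    ((measurable_card_of_mem hA).max measurable_const)

theorem measurable_tdp {Ω : Type*} [MeasurableSpace Ω] {m : ℕ}
    {A : Ω → Finset (Fin m)} (hA : ∀ j, MeasurableSet {ω | j ∈ A ω}) {null : Ω → Fin m → Bool}
    (hnull : ∀ k, Measurable fun ω => null ω k) : Measurable fun ω => tdp (null ω) (A ω) :=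
  ((measurable_card_of_mem hA).sub
    (measurable_card_of_mem (measurableSet_mem_filter hA hnull true))).div
    ((measurable_card_of_mem (measurableSet_mem_filter (A := fun _ => Finset.univ)
      (by simp) hnull false)).max measurable_const)

/-- After division by `m` the guard `1` becomes `1 / m` and disappears in the limit. -/
theorem tendsto_div_max_one {u v : ℕ → ℝ} {a b : ℝ}
    (hu : Tendsto (fun m => u m / m) atTop (𝓝 a)) (hv : Tendsto (fun m => v m / m) atTop (𝓝 b))
    (hb : 0 < b) : Tendsto (fun m => u m / max (v m) 1) atTop (𝓝 (a / b)) := by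
  have h1 : Tendsto (fun m : ℕ => max (v m / m) (1 / (m : ℝ))) atTop (𝓝 (max b 0)) :=
    hv.max tendsto_one_div_atTop_nhds_zero_nat
  rw [max_eq_left hb.le] at h1
  refine (hu.div h1 hb.ne').congr' ?_
  filter_upwards [eventually_gt_atTop 0] with m hm
  have hm' : (0 : ℝ) < m := by exact_mod_cast hm
  rw [Pi.div_apply, max_div_div_right hm'.le, div_div_div_cancel_right₀ hm'.ne']

/-- If the proportions of rejections, of false rejections and of true alternatives converge almost
surely to constants, then FDR and power converge. -/
theorem tendsto_integral_fdp_tdp {Ω : Type*} [MeasurableSpace Ω] {μ : Measure Ω}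
    [IsProbabilityMeasure μ] {null : (m : ℕ) → Ω → Fin m → Bool}
    {A : (m : ℕ) → Ω → Finset (Fin m)} {V R M : ℝ} (hR : 0 < R) (hM : 0 < M)
    (hnull : ∀ m k, Measurable fun ω => null m ω k) (hA : ∀ m j, MeasurableSet {ω | j ∈ A m ω})
    (hAV : ∀ᵐ ω ∂μ, Tendsto
      (fun m => (((A m ω).filter (fun j => null m ω j = true)).card : ℝ) / m) atTop (𝓝 V))
    (hAR : ∀ᵐ ω ∂μ, Tendsto (fun m => ((A m ω).card : ℝ) / m) atTop (𝓝 R))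
    (hm1 : ∀ᵐ ω ∂μ, Tendsto (fun m => ((Finset.univ.filter
      (fun j => null m ω j = false)).card : ℝ) / m) atTop (𝓝 M)) :
    Tendsto (fun m => ∫ ω, fdp (null m ω) (A m ω) ∂μ) atTop (𝓝 (V / R)) ∧
    Tendsto (fun m => ∫ ω, tdp (null m ω) (A m ω) ∂μ) atTop (𝓝 ((R - V) / M)) := by
  have hconst : ∀ c : ℝ, c = ∫ _, c ∂μ := fun c => by simp
  constructor
  · rw [hconst (V / R)]
    refine tendsto_integral_of_dominated_convergence (fun _ => 1)
      (fun m => (measurable_fdp (hA m) (hnull m)).aestronglyMeasurable) (integrable_const _)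
      (fun m => ae_of_all _ fun ω => ?_) ?_
    · have := fdp_mem_Icc (null m ω) (A m ω)
      rw [Real.norm_of_nonneg this.1]
      exact this.2
    · filter_upwards [hAV, hAR] with ω h1 h2
      exact tendsto_div_max_one h1 h2 hR
  · rw [hconst ((R - V) / M)]
    refine tendsto_integral_of_dominated_convergence (fun _ => 1)
      (fun m => (measurable_tdp (hA m) (hnull m)).aestronglyMeasurable) (integrable_const _)
      (fun m => ae_of_all _ fun ω => ?_) ?_
    · have := tdp_mem_Icc (null m ω) (A m ω)
      rw [Real.norm_of_nonneg this.1]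
      exact this.2
    · filter_upwards [hAV, hAR, hm1] with ω h1 h2 h3
      refine tendsto_div_max_one ((h2.sub h1).congr fun m => ?_) h3 hM
      rw [sub_div]

/-! ### Range and measurability of the plug-in levels. -/

theorem sum_card_nodeSet {N m : ℕ} (node : Fin m → Fin N) :
    ∑ i, (nodeSet node i).card = m := by
  have h := Finset.card_eq_sum_card_fiberwise (f := node) (s := Finset.univ)
    (t := Finset.univ) (by simp)
  simpa [nodeSet] using h.symm

theorem globalNullEstimate_mem_Icc {N m : ℕ} (node : Fin m → Fin N) {rhat : Fin N → ℝ}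
    (h : ∀ i, rhat i ∈ Set.Icc (0 : ℝ) 1) : globalNullEstimate node rhat ∈ Set.Icc (0 : ℝ) 1 := by
  rw [globalNullEstimate]
  refine ⟨mul_nonneg (by positivity)
    (Finset.sum_nonneg fun i _ => mul_nonneg (h i).1 (by positivity)), ?_⟩
  have hle : ∑ i, rhat i * ((nodeSet node i).card : ℝ) ≤ m := by
    calc ∑ i, rhat i * ((nodeSet node i).card : ℝ)
        ≤ ∑ i, ((nodeSet node i).card : ℝ) :=
          Finset.sum_le_sum fun i _ => mul_le_of_le_one_left (by positivity) (h i).2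
      _ = m := by exact_mod_cast sum_card_nodeSet node
  rw [one_div_mul_eq_div]
  exact div_le_one_of_le₀ hle (by positivity)

theorem localLevel_nonneg {N m : ℕ} {α : ℝ} (hα : α ∈ Set.Ioo (0 : ℝ) 1) (node : Fin m → Fin N)
    {rhat : Fin N → ℝ} (h : ∀ i, rhat i ∈ Set.Icc (0 : ℝ) 1) (i : Fin N) :
    0 ≤ localLevel α node rhat i := by
  have hg := globalNullEstimate_mem_Icc node h
  have h1 : 1 ≤ 1 / α := (one_le_div hα.1).2 hα.2.le
  have hs : 0 ≤ slopeEstimate α node rhat :=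
    div_nonneg (by linarith [hg.2]) (by linarith [hg.2])
  have := h i
  exact one_div_nonneg.2 (add_nonneg (mul_nonneg (by linarith [this.2]) hs) this.1)

theorem measurableSet_mem_nodeSet {Ω : Type*} [MeasurableSpace Ω] {N m : ℕ}
    {node : Ω → Fin m → Fin N} (hnode : ∀ k, Measurable fun ω => node ω k) (i : Fin N)
    (j : Fin m) : MeasurableSet {ω | j ∈ nodeSet (node ω) i} := by
  simp only [nodeSet, Finset.mem_filter, Finset.mem_univ, true_and]
  exact hnode j (measurableSet_singleton i)

theorem measurable_localLevel {Ω : Type*} [MeasurableSpace Ω] {N m : ℕ} (α : ℝ)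
    {node : Ω → Fin m → Fin N} (hnode : ∀ k, Measurable fun ω => node ω k)
    {rhat : Ω → Fin N → ℝ} (hrhat : ∀ i, Measurable fun ω => rhat ω i) (i : Fin N) :
    Measurable fun ω => localLevel α (node ω) (rhat ω) i := by
  have hc := fun i => measurable_card_of_mem (measurableSet_mem_nodeSet hnode i)
  have hg : Measurable fun ω => globalNullEstimate (node ω) (rhat ω) :=
    (Finset.measurable_fun_sum _ fun i _ => (hrhat i).mul (hc i)).const_mul _
  have hs : Measurable fun ω => slopeEstimate α (node ω) (rhat ω) :=
    (measurable_const.sub hg).div (measurable_const.sub hg)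
  exact measurable_const.div (((measurable_const.sub (hrhat i)).mul hs).add (hrhat i))

theorem measurableSet_mem_globalReject {Ω : Type*} [MeasurableSpace Ω] {m : ℕ} {α : ℝ}
    (hα : 0 ≤ α) {P : Ω → Fin m → ℝ} (hP : ∀ j, Measurable fun ω => P ω j) (j : Fin m) :
    MeasurableSet {ω | j ∈ globalReject α (P ω)} :=
  measurableSet_mem_bhReject (S := fun _ => Finset.univ) (a := fun _ => α) hP (by simp)
    measurable_const (fun _ => hα) j

theorem measurableSet_mem_distReject {Ω : Type*} [MeasurableSpace Ω] {N m : ℕ} {α : ℝ}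
    (hα : α ∈ Set.Ioo (0 : ℝ) 1) {node : Ω → Fin m → Fin N}
    (hnode : ∀ k, Measurable fun ω => node ω k) {rhat : Ω → Fin N → ℝ}
    (hrhat : ∀ i, Measurable fun ω => rhat ω i) (hmem : ∀ ω i, rhat ω i ∈ Set.Icc (0 : ℝ) 1)
    {P : Ω → Fin m → ℝ} (hP : ∀ j, Measurable fun ω => P ω j) (j : Fin m) :
    MeasurableSet {ω | j ∈ distReject α (node ω) (rhat ω) (P ω)} := by
  simp only [distReject, Finset.mem_biUnion, Finset.mem_univ, true_and, Set.ofPred_exists]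
  exact MeasurableSet.iUnion fun i => measurableSet_mem_bhReject hP
    (measurableSet_mem_nodeSet hnode i) (measurable_localLevel α hnode hrhat i)
    (fun ω => localLevel_nonneg hα _ (hmem ω) i) j

/-! ### Almost sure convergence of cell proportions. -/

/-- The strong law of large numbers for a triangular array of independent events. -/
theorem ae_tendsto_sum_indicator {Ω : Type*} [MeasurableSpace Ω] {μ : Measure Ω}
    [IsProbabilityMeasure μ] {E : Type*} [MeasurableSpace E] {X : (m : ℕ) → Fin m → Ω → E}
    (hX : ∀ m k, Measurable (X m k)) (hind : ∀ m, iIndepFun (X m) μ) {B : Set E}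
    (hB : MeasurableSet B) {b : ℝ}
    (hb : Tendsto (fun m : ℕ => (∑ k, (μ.map (X m k)).real B) / m) atTop (𝓝 b)) :
    ∀ᵐ ω ∂μ, Tendsto (fun m : ℕ => (∑ k, B.indicator (fun _ => (1 : ℝ)) (X m k ω)) / m)
      atTop (𝓝 b) := by
  set Y : (m : ℕ) → Fin m → Ω → ℝ := fun m k ω =>
    B.indicator (fun _ => (1 : ℝ)) (X m k ω) - (μ.map (X m k)).real B with hY
  have hYind : ∀ m, iIndepFun (Y m) μ := fun m =>
    (hind m).comp (fun k e => B.indicator (fun _ => (1 : ℝ)) e - (μ.map (X m k)).real B)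
      fun k => (measurable_const.indicator hB).sub_const _
  -- Hoeffding's lemma: a centred indicator is sub-Gaussian with variance proxy `1 / 4`.
  have hsub : ∀ m k, HasSubgaussianMGF (Y m k) ((‖(1 : ℝ) - 0‖₊ / 2) ^ 2) μ := by
    intro m k
    have hmeas : Measurable fun ω => B.indicator (fun _ => (1 : ℝ)) (X m k ω) :=
      (measurable_const.indicator hB).comp (hX m k)
    have h := hasSubgaussianMGF_of_mem_Icc (μ := μ) (a := 0) (b := 1) hmeas.aemeasurable
      (ae_of_all _ fun ω => by
        by_cases h : X m k ω ∈ B <;> simp [h])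
    have hint : ∫ ω, B.indicator (fun _ => (1 : ℝ)) (X m k ω) ∂μ = (μ.map (X m k)).real B := by
      rw [← integral_map (hX m k).aemeasurable
        (f := B.indicator (fun _ => (1 : ℝ)))
        (measurable_const.indicator hB).aestronglyMeasurable, integral_indicator_const _ hB]
      simp
    rwa [hint] at h
  -- The total proxy is `m / 4`, so the Chernoff exponent is `-(ε m)² / (2 · m / 4) = -2 ε² m`.
  have hexp : ∀ ε : ℝ, 0 < ε → ∀ m : ℕ, ∀ Z : Fin m → Ω → ℝ, iIndepFun Z μ →
      (∀ k, HasSubgaussianMGF (Z k) ((‖(1 : ℝ) - 0‖₊ / 2) ^ 2) μ) →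
      μ {ω | ε * m ≤ ∑ k, Z k ω} ≤ ENNReal.ofReal (Real.exp (-(2 * ε ^ 2)) ^ m) := by
    intro ε hε m Z hZ hZs
    have h := HasSubgaussianMGF.measure_sum_ge_le_of_iIndepFun hZ (s := Finset.univ)
      (fun k _ => hZs k) (show 0 ≤ ε * m by positivity)
    rw [← ofReal_measureReal]
    refine ENNReal.ofReal_le_ofReal (h.trans (le_of_eq ?_))
    rw [← Real.exp_nat_mul]
    congr 1
    rcases eq_or_ne m 0 with rfl | hm
    · simp
    · have : (m : ℝ) ≠ 0 := by exact_mod_cast hm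
      simp
      field_simp
  have hsum : ∀ ε : ℝ, 0 < ε →
      (∑' m : ℕ, ENNReal.ofReal (Real.exp (-(2 * ε ^ 2)) ^ m)) ≠ ⊤ := by
    intro ε hε
    refine (summable_geometric_of_lt_one (Real.exp_nonneg _) ?_).tsum_ofReal_ne_top
    rw [Real.exp_lt_one_iff]
    have := pow_pos hε 2
    linarith
  -- The geometric tail bounds are summable, and the first Borel–Cantelli lemma needs no
  -- independence between different `m`.
  have hev : ∀ ε : ℝ, 0 < ε → ∀ Z : (m : ℕ) → Fin m → Ω → ℝ, (∀ m, iIndepFun (Z m) μ) →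
      (∀ m k, HasSubgaussianMGF (Z m k) ((‖(1 : ℝ) - 0‖₊ / 2) ^ 2) μ) →
      ∀ᵐ ω ∂μ, ∀ᶠ m : ℕ in atTop, ∑ k, Z m k ω < ε * m := by
    intro ε hε Z hZ hZs
    have h := ae_eventually_notMem (μ := μ) (s := fun m : ℕ => {ω | ε * m ≤ ∑ k, Z m k ω})
      (ne_top_of_le_ne_top (hsum ε hε)
        (ENNReal.tsum_le_tsum fun m => hexp ε hε m (Z m) (hZ m) (hZs m)))
    filter_upwards [h] with ω hω
    filter_upwards [hω] with m hm
    simpa using hm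
  have hlim : ∀ᵐ ω ∂μ, ∀ n : ℕ, ∀ᶠ m : ℕ in atTop,
      |∑ k, Y m k ω| < 1 / ((n : ℝ) + 1) * m := by
    rw [ae_all_iff]
    intro n
    have hn : 0 < 1 / ((n : ℝ) + 1) := by positivity
    -- The one-sided bound is used for `Y` and for `-Y`.
    filter_upwards [hev _ hn Y hYind hsub, hev _ hn (fun m k => -Y m k)
      (fun m => (hYind m).comp (fun _ x => -x) fun _ => measurable_neg)
      (fun m k => (hsub m k).neg)] with ω h1 h2
    filter_upwards [h1, h2] with m h3 h4
    rw [abs_lt]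
    simp only [Pi.neg_apply, Finset.sum_neg_distrib] at h4
    exact ⟨by linarith, h3⟩
  filter_upwards [hlim] with ω hω
  have h0 : Tendsto (fun m : ℕ => (∑ k, Y m k ω) / m) atTop (𝓝 0) := by
    rw [Metric.tendsto_atTop']
    intro ε hε
    obtain ⟨n, hn⟩ := exists_nat_one_div_lt hε
    obtain ⟨M, hM⟩ := eventually_atTop.1 (hω n)
    refine ⟨M, fun m hm => ?_⟩
    have hm0 : (0 : ℝ) < m := by exact_mod_cast (Nat.zero_le M).trans_lt hm
    rw [Real.dist_eq, sub_zero, abs_div, abs_of_pos hm0, div_lt_iff₀ hm0]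
    refine (hM m hm.le).trans ?_
    gcongr
  have := h0.add hb
  rw [zero_add] at this
  refine this.congr fun m => ?_
  rw [← add_div, ← Finset.sum_add_distrib]
  simp [hY]

/-- The weight of an event of the mixture model is a combination of the node probabilities. -/
theorem entryLaw_real {N : ℕ} {q r₀ : Fin N → ℝ} (ν : Measure ℝ) [IsProbabilityMeasure ν]
    (hq : ∀ i, 0 ≤ q i) (hr₀ : ∀ i, r₀ i ∈ Set.Ico (0 : ℝ) 1) (i : Fin N) (b : Bool) {C : Set ℝ} :
    (entryLaw q r₀ ν).real ({i} ×ˢ {b} ×ˢ C) =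
      q i * (bif b then r₀ i * unif01.real C else (1 - r₀ i) * ν.real C) := by
  have : IsFiniteMeasure unif01 := by rw [unif01]; infer_instance
  rw [Measure.real, entryLaw, Measure.finsetSum_apply, Finset.sum_eq_single i]
  · rw [Measure.smul_apply, Measure.prod_prod, Measure.add_apply, Measure.smul_apply,
      Measure.smul_apply, Measure.prod_prod, Measure.prod_prod]
    have h1 := ENNReal.toReal_ofReal (hr₀ i).1
    have h2 := ENNReal.toReal_ofReal (sub_nonneg.2 (hr₀ i).2.le)
    have h3 := ENNReal.toReal_ofReal (hq i)
    cases b <;> simp [Measure.real, h1, h2, h3]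
  · intro j _ hj
    rw [Measure.smul_apply, Measure.prod_prod]
    simp [hj]
  · simp

/-- The limit law at the level of single cells. -/
theorem ae_tendsto_cell_count {N : ℕ} {Ω : Type*} [MeasurableSpace Ω] {μ : Measure Ω}
    [IsProbabilityMeasure μ] {r₀ : Fin N → ℝ} (hr₀ : ∀ i, r₀ i ∈ Set.Ico (0 : ℝ) 1)
    {ν : Measure ℝ} [IsProbabilityMeasure ν]
    {q : ℕ → Fin N → ℝ} (hq_nonneg : ∀ m i, 0 ≤ q m i)
    {qlim : Fin N → ℝ} (hq_lim : ∀ i, Tendsto (fun m => q m i) atTop (𝓝 (qlim i)))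
    {scheme : Scheme}
    {node : (m : ℕ) → Ω → Fin m → Fin N} {null : (m : ℕ) → Ω → Fin m → Bool}
    {p : (m : ℕ) → Ω → Fin m → ℝ} (hsample : IsNetworkSample μ scheme q r₀ ν node null p)
    (i : Fin N) (b : Bool) {C : Set ℝ} (hC : MeasurableSet C) [DecidablePred (· ∈ C)] :
    ∀ᵐ ω ∂μ, Tendsto (fun m : ℕ => ((Finset.univ.filter fun k : Fin m =>
      node m ω k = i ∧ null m ω k = b ∧ p m ω k ∈ C).card : ℝ) / m) atTop
      (𝓝 (qlim i * (bif b then r₀ i * unif01.real C else (1 - r₀ i) * ν.real C))) := by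
  set w : ℝ := bif b then r₀ i * unif01.real C else (1 - r₀ i) * ν.real C
  have hmean : Tendsto (fun m : ℕ => (∑ k : Fin m, q (scheme.index m k) i) / m) atTop
      (𝓝 (qlim i)) := by
    cases scheme with
    | array =>
      refine (hq_lim i).congr' ?_
      filter_upwards [eventually_gt_atTop 0] with m hm
      have : (m : ℝ) ≠ 0 := by exact_mod_cast hm.ne'
      simp only [Scheme.index, Finset.sum_const, Finset.card_univ, Fintype.card_fin, nsmul_eq_mul]
      field_simp
    | sequential =>
      -- Here the average probability is a Cesàro mean of the shifted sequence `q (k + 1)`.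
      have h := ((tendsto_add_atTop_iff_nat 1).2 (hq_lim i)).cesaro
      refine h.congr fun m => ?_
      rw [div_eq_inv_mul]
      congr 1
      exact (Fin.sum_univ_eq_sum_range (fun k => q (k + 1) i) m).symm
  have hB : MeasurableSet (({i} : Set (Fin N)) ×ˢ ({b} : Set Bool) ×ˢ C) :=
    (measurableSet_singleton i).prod ((measurableSet_singleton b).prod hC)
  have h := ae_tendsto_sum_indicator (μ := μ)
    (X := fun m k ω => (node m ω k, null m ω k, p m ω k))
    (fun m k => (hsample.measurable_node m k).prodMk
      ((hsample.measurable_null m k).prodMk (hsample.measurable_p m k)))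
    hsample.indep hB (b := qlim i * w) (by
      refine (hmean.mul_const w).congr fun m => ?_
      simp only [hsample.law, entryLaw_real ν (hq_nonneg _) hr₀]
      rw [← Finset.sum_mul, mul_div_right_comm])
  filter_upwards [h] with ω hω
  refine hω.congr fun m => ?_
  simp [Set.indicator_apply]

/-! ### The last crossing of a distribution function with a line. -/

section Crossing

variable {ν : Measure ℝ} {β : ℝ}

theorem bddAbove_setOf_mul_le_cdf (hβ : 0 < β) : BddAbove {t | β * t ≤ cdf ν t} :=
  ⟨1 / β, fun t ht => by
    rw [le_div_iff₀' hβ]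
    exact le_trans ht (cdf_le_one ν t)⟩

theorem bddAbove_crossings (hβ : 0 < β) : BddAbove {t | cdf ν t = β * t} :=
  (bddAbove_setOf_mul_le_cdf (ν := ν) hβ).mono fun _ ht => ht.ge

/-- A distribution function cannot jump down across the line: by monotonicity alone, the supremum of
`{t | β * t ≤ F t}`, if this set is nonempty, is itself a crossing. Hence no point of the set lies
beyond the last crossing. -/
theorem cdf_lt_of_lastCrossing_lt (hβ : 0 < β) {t : ℝ}
    (ht : lastCrossing (fun t => cdf ν t) β < t) : cdf ν t < β * t := by
  by_contra hcon
  set A : Set ℝ := {t | β * t ≤ cdf ν t}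
  have hA : BddAbove A := bddAbove_setOf_mul_le_cdf hβ
  have htA : t ∈ A := not_lt.1 hcon
  have h1 : β * sSup A ≤ cdf ν (sSup A) := by
    rw [← le_div_iff₀' hβ]
    refine csSup_le ⟨t, htA⟩ fun s hs => ?_
    rw [le_div_iff₀' hβ]
    exact le_trans hs (monotone_cdf ν (le_csSup hA hs))
  have h2 : cdf ν (sSup A) ≤ β * sSup A := by
    rw [← div_le_iff₀' hβ]
    refine le_of_forall_gt_imp_ge_of_dense fun s hs => ?_
    have hsA : s ∉ A := fun h => not_lt.2 (le_csSup hA h) hs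
    rw [div_le_iff₀' hβ]
    exact (monotone_cdf ν hs.le).trans (not_le.1 hsA).le
  have h3 : sSup A ≤ lastCrossing (fun t => cdf ν t) β :=
    le_csSup (bddAbove_crossings hβ) (le_antisymm h2 h1)
  exact absurd (le_csSup hA htA) (not_le.2 (h3.trans_lt ht))

theorem cdf_lastCrossing (hβ : 0 < β) (hpos : 0 < lastCrossing (fun t => cdf ν t) β) :
    cdf ν (lastCrossing (fun t => cdf ν t) β) = β * lastCrossing (fun t => cdf ν t) β := by
  set τ := lastCrossing (fun t => cdf ν t) β with hτ
  -- Without crossings `sSup` would take its default value `0`, contrary to `hpos`.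
  have hne : {t | cdf ν t = β * t}.Nonempty := by
    by_contra h
    rw [Set.not_nonempty_iff_eq_empty] at h
    rw [hτ, lastCrossing, h, Real.sSup_empty] at hpos
    exact lt_irrefl _ hpos
  apply le_antisymm
  · rw [← div_le_iff₀' hβ]
    refine le_of_forall_gt_imp_ge_of_dense fun s hs => ?_
    rw [div_le_iff₀' hβ]
    exact (monotone_cdf ν hs.le).trans (cdf_lt_of_lastCrossing_lt hβ hs).le
  · rw [← le_div_iff₀' hβ]
    refine csSup_le hne fun s hs => ?_
    rw [le_div_iff₀' hβ]
    exact hs.ge.trans (monotone_cdf ν (le_csSup (bddAbove_crossings hβ) hs))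

/-- Right of `τ` the graph is under the line, so the difference quotients there give `F'(τ) ≤ β`,
hence `F'(τ) < β`. Quotients from the left are then also below `β`, which puts the graph above the
line just left of `τ`. -/
theorem eventually_lt_cdf_of_deriv_ne (hβ : 0 < β)
    (hpos : 0 < lastCrossing (fun t => cdf ν t) β)
    (hd : DifferentiableAt ℝ (fun t => cdf ν t) (lastCrossing (fun t => cdf ν t) β))
    (hne : deriv (fun t => cdf ν t) (lastCrossing (fun t => cdf ν t) β) ≠ β) :
    ∀ᶠ t in 𝓝[<] lastCrossing (fun t => cdf ν t) β, β * t < cdf ν t := by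
  have heq := cdf_lastCrossing (ν := ν) hβ hpos
  have hgt := fun t => cdf_lt_of_lastCrossing_lt (ν := ν) (t := t) hβ
  set τ := lastCrossing (fun t => cdf ν t) β
  have hs := hasDerivAt_iff_tendsto_slope.1 hd.hasDerivAt
  have hle : deriv (fun t => cdf ν t) τ ≤ β := by
    refine le_of_tendsto (hs.mono_left (nhdsGT_le_nhdsNE τ)) ?_
    filter_upwards [self_mem_nhdsWithin] with t ht
    have ht' : τ < t := ht
    rw [slope_def_field, div_le_iff₀ (sub_pos.2 ht'), heq]
    linarith [hgt t ht']
  have hlt := (hs.mono_left (nhdsLT_le_nhdsNE τ)).eventually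
    (gt_mem_nhds (lt_of_le_of_ne hle hne))
  filter_upwards [hlt, self_mem_nhdsWithin] with t ht1 ht2
  have ht2' : t < τ := ht2
  rw [slope_def_field, div_lt_iff_of_neg (sub_neg.2 ht2'), heq] at ht1
  linarith

end Crossing

/-! ### The common limiting threshold of all mixtures. -/

instance : IsProbabilityMeasure unif01 := ⟨by simp [unif01]⟩

theorem unif01_real_Iic_of_mem {t : ℝ} (ht : t ∈ Set.Icc (0 : ℝ) 1) :
    unif01.real (Set.Iic t) = t := by
  have : Set.Iic t ∩ Set.Icc 0 1 = Set.Icc 0 t := by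
    ext x
    simp only [Set.mem_inter_iff, Set.mem_Iic, Set.mem_Icc]
    exact ⟨fun h => ⟨h.2.1, h.1⟩, fun h => ⟨h.2, h.1, h.2.trans ht.2⟩⟩
  rw [unif01, measureReal_restrict_apply measurableSet_Iic, this]
  simp [ht.1]

theorem unif01_real_Iic_le {t : ℝ} (ht : 0 ≤ t) : unif01.real (Set.Iic t) ≤ t := by
  rcases le_total t 1 with h | h
  · exact (unif01_real_Iic_of_mem ⟨ht, h⟩).le
  · exact measureReal_le_one.trans h

theorem continuousAt_unif01_real_Iic {τ : ℝ} (hτ : τ ∈ Set.Ioo (0 : ℝ) 1) :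
    ContinuousAt (fun t => unif01.real (Set.Iic t)) τ :=
  continuousAt_id.congr <| by
    filter_upwards [Ioo_mem_nhds hτ.1 hτ.2] with t ht
    exact (unif01_real_Iic_of_mem ⟨ht.1.le, ht.2.le⟩).symm

theorem continuousWithinAt_real_Iic (ν : Measure ℝ) [IsProbabilityMeasure ν] (t : ℝ) :
    ContinuousWithinAt (fun t => ν.real (Set.Iic t)) (Set.Ioi t) t := by
  simp only [← cdf_eq_real]
  exact ((cdf ν).right_continuous t).mono Set.Ioi_subset_Ici_self

/-- BH at the level `1 / ((1 - r) β + r)` applied to p-values whose empirical distribution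
functions converge to `r t + (1 - r) F(t)` has a limiting threshold that does not depend on `r`. -/
theorem tendsto_bhThreshold_mixture {p : (m : ℕ) → Fin m → ℝ} {S : (m : ℕ) → Finset (Fin m)}
    {a : ℕ → ℝ} {ν : Measure ℝ} [IsProbabilityMeasure ν] {β τ r : ℝ} (hβ : 1 < β)
    (hr : r ∈ Set.Ico (0 : ℝ) 1) (hτ : τ ∈ Set.Ioo (0 : ℝ) 1)
    (hright : ∀ t, τ < t → ν.real (Set.Iic t) < β * t)
    (hleft : ∀ᶠ t in 𝓝[<] τ, β * t < ν.real (Set.Iic t))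
    (ha_nonneg : ∀ m, 0 ≤ a m) (ha : Tendsto a atTop (𝓝 (1 / ((1 - r) * β + r))))
    (hG : ∀ t : ℚ, Tendsto (fun m => (countLE (p m) (S m) t : ℝ) / ((S m).card : ℝ)) atTop
      (𝓝 (r * unif01.real (Set.Iic (t : ℝ)) + (1 - r) * ν.real (Set.Iic (t : ℝ))))) :
    Tendsto (fun m => bhThreshold (p m) (S m) (a m)) atTop (𝓝 τ) := by
  have hr1 : 0 < 1 - r := sub_pos.2 hr.2
  have hden : 0 < (1 - r) * β + r :=
    add_pos_of_pos_of_nonneg (mul_pos hr1 (zero_lt_one.trans hβ)) hr.1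
  refine tendsto_bhThreshold
    (G := fun t => r * unif01.real (Set.Iic t) + (1 - r) * ν.real (Set.Iic t))
    ha_nonneg ha hG (fun t => ?_) (fun t ht => ?_) ?_
  · exact ((continuousWithinAt_real_Iic unif01 t).const_mul r).add
      ((continuousWithinAt_real_Iic ν t).const_mul (1 - r))
  -- The null terms compare as `r U(t) ≤ r t`, also for `t > 1`; strictness comes from the
  -- alternative term, whose weight `1 - r` is positive.
  · rw [one_div_mul_eq_div, div_lt_iff₀ hden]
    have h1 := mul_le_mul_of_nonneg_left (unif01_real_Iic_le (hτ.1.trans ht).le) hr.1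
    have h2 := mul_lt_mul_of_pos_left (hright t ht) hr1
    linarith
  · filter_upwards [hleft, Ioo_mem_nhdsLT hτ.1] with t ht1 ht2
    rw [one_div_mul_eq_div, lt_div_iff₀ hden,
      unif01_real_Iic_of_mem ⟨ht2.1.le, (ht2.2.trans hτ.2).le⟩]
    have h2 := mul_lt_mul_of_pos_left ht1 hr1
    linarith

/-! ### Decomposition of all counts into cells. -/

/-- The number of p-values at most `t` in node `i` whose null hypothesis has truth value `b`. -/
noncomputable def cellCount {N m : ℕ} (node : Fin m → Fin N) (null : Fin m → Bool) (p : Fin m → ℝ)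
    (i : Fin N) (b : Bool) (t : ℝ) : ℕ :=
  (Finset.univ.filter fun k => node k = i ∧ null k = b ∧ p k ≤ t).card

/-- The number of p-values in node `i` whose null hypothesis has truth value `b`. -/
noncomputable def cellCard {N m : ℕ} (node : Fin m → Fin N) (null : Fin m → Bool)
    (i : Fin N) (b : Bool) : ℕ :=
  (Finset.univ.filter fun k => node k = i ∧ null k = b).card

/-- The limiting proportion of p-values with truth value `b` and value at most `t` within a node
with null proportion `r`. -/
noncomputable def cellWeight (ν : Measure ℝ) (r : ℝ) (b : Bool) (t : ℝ) : ℝ :=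
  bif b then r * unif01.real (Set.Iic t) else (1 - r) * ν.real (Set.Iic t)

section Counting

variable {N m : ℕ} (node : Fin m → Fin N) (null : Fin m → Bool) (p : Fin m → ℝ)

theorem cellCount_mono (i : Fin N) (b : Bool) : Monotone (cellCount node null p i b) :=
  fun _ _ h => Finset.card_le_card
    (Finset.monotone_filter_right _ fun _ _ hj => ⟨hj.1, hj.2.1, hj.2.2.trans h⟩)

theorem cellCount_le_cellCard (i : Fin N) (b : Bool) (t : ℝ) :
    cellCount node null p i b t ≤ cellCard node null i b :=
  Finset.card_le_card (Finset.monotone_filter_right _ fun _ _ hj => ⟨hj.1, hj.2.1⟩)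

theorem card_eq_sum_node (A : Finset (Fin m)) :
    A.card = ∑ i, (A.filter fun k => node k = i).card :=
  Finset.card_eq_sum_card_fiberwise (by simp)

theorem countLE_nodeSet (i : Fin N) (t : ℝ) : countLE p (nodeSet node i) t =
    cellCount node null p i true t + cellCount node null p i false t := by
  rw [countLE, ← card_filter_null_add null, nodeSet]
  simp only [Finset.filter_filter, cellCount]
  congr 2 <;> ext k <;> simp <;> tauto

theorem card_nodeSet (i : Fin N) : (nodeSet node i).card =
    cellCard node null i true + cellCard node null i false := by
  rw [← card_filter_null_add null, nodeSet]
  simp only [Finset.filter_filter, cellCard]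

theorem card_filter_null (b : Bool) : (Finset.univ.filter fun k => null k = b).card =
    ∑ i, cellCard node null i b := by
  rw [card_eq_sum_node node]
  simp only [Finset.filter_filter, cellCard, and_comm]

theorem countLE_univ (t : ℝ) : countLE p Finset.univ t =
    ∑ i, (cellCount node null p i true t + cellCount node null p i false t) := by
  rw [countLE, card_eq_sum_node node]
  refine Finset.sum_congr rfl fun i _ => ?_
  rw [← countLE_nodeSet, countLE, nodeSet]
  simp only [Finset.filter_filter, and_comm]

theorem card_filter_globalReject (α : ℝ) (b : Bool) :
    ((globalReject α p).filter fun k => null k = b).card =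
      ∑ i, cellCount node null p i b (bhThreshold p Finset.univ α) := by
  rw [card_eq_sum_node node]
  refine Finset.sum_congr rfl fun i _ => congrArg Finset.card ?_
  ext k
  simp [globalReject, bhReject]
  tauto

theorem mem_nodeSet (i : Fin N) (k : Fin m) : k ∈ nodeSet node i ↔ node k = i := by
  simp [nodeSet]

/-- The same cell sum as for the global procedure, except that each node has its own threshold; the
two therefore share a limit once all relevant thresholds do. -/
theorem card_filter_distReject (α : ℝ) (rhat : Fin N → ℝ) (b : Bool) :
    ((distReject α node rhat p).filter fun k => null k = b).card =
      ∑ i, cellCount node null p i b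
        (bhThreshold p (nodeSet node i) (localLevel α node rhat i)) := by
  rw [card_eq_sum_node node]
  refine Finset.sum_congr rfl fun i _ => congrArg Finset.card ?_
  ext k
  simp only [distReject, bhReject, mem_nodeSet, Finset.mem_filter, Finset.mem_biUnion,
    Finset.mem_univ, true_and]
  constructor
  · rintro ⟨⟨⟨j, rfl, h⟩, hb⟩, rfl⟩
    exact ⟨rfl, hb, h⟩
  · rintro ⟨rfl, hb, h⟩
    exact ⟨⟨⟨_, rfl, h⟩, hb⟩, rfl⟩

end Counting

theorem continuousAt_cellWeight {ν : Measure ℝ} {τ : ℝ} (hτ : τ ∈ Set.Ioo (0 : ℝ) 1)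
    (hν : ContinuousAt (fun t => ν.real (Set.Iic t)) τ) (r : ℝ) (b : Bool) :
    ContinuousAt (cellWeight ν r b) τ := by
  cases b
  · exact hν.const_mul (1 - r)
  · exact (continuousAt_unif01_real_Iic hτ).const_mul r

/-! ### Deterministic limits along a regular sequence of networks. -/

/-- A sequence of networks is regular if the proportions of p-values in all cells converge to their
values under the limiting mixture model. -/
structure IsRegular {N : ℕ} (q r₀ : Fin N → ℝ) (ν : Measure ℝ)
    (node : (m : ℕ) → Fin m → Fin N) (null : (m : ℕ) → Fin m → Bool)
    (p : (m : ℕ) → Fin m → ℝ) : Prop where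
  count : ∀ i b, ∀ t : ℚ, Tendsto (fun m : ℕ =>
    (cellCount (node m) (null m) (p m) i b t : ℝ) / m) atTop (𝓝 (q i * cellWeight ν (r₀ i) b t))
  card : ∀ i b, Tendsto (fun m : ℕ => (cellCard (node m) (null m) i b : ℝ) / m) atTop
    (𝓝 (q i * bif b then r₀ i else 1 - r₀ i))

namespace IsRegular

variable {N : ℕ} {q r₀ : Fin N → ℝ} {ν : Measure ℝ} {node : (m : ℕ) → Fin m → Fin N}
  {null : (m : ℕ) → Fin m → Bool} {p : (m : ℕ) → Fin m → ℝ}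

theorem tendsto_card_nodeSet (h : IsRegular q r₀ ν node null p) (i : Fin N) :
    Tendsto (fun m : ℕ => ((nodeSet (node m) i).card : ℝ) / m) atTop (𝓝 (q i)) := by
  have h1 := (h.card i true).add (h.card i false)
  rw [cond_true, cond_false, ← mul_add, add_sub_cancel, mul_one] at h1
  refine h1.congr fun m => ?_
  rw [card_nodeSet (node m) (null m)]
  push_cast
  ring

theorem tendsto_card_filter_null (h : IsRegular q r₀ ν node null p) :
    Tendsto (fun m : ℕ => ((Finset.univ.filter fun k => null m k = false).card : ℝ) / m) atTop
      (𝓝 (∑ i, q i * (1 - r₀ i))) := by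
  refine (tendsto_finsetSum Finset.univ fun i _ => h.card i false).congr fun m => ?_
  rw [card_filter_null (node m) (null m), ← Finset.sum_div]
  push_cast
  rfl

theorem tendsto_countLE_nodeSet (h : IsRegular q r₀ ν node null p) {i : Fin N} (hi : 0 < q i)
    (t : ℚ) : Tendsto (fun m => (countLE (p m) (nodeSet (node m) i) t : ℝ) /
      ((nodeSet (node m) i).card : ℝ)) atTop
      (𝓝 (r₀ i * unif01.real (Set.Iic (t : ℝ)) + (1 - r₀ i) * ν.real (Set.Iic (t : ℝ)))) := by
  have h1 := ((h.count i true t).add (h.count i false t)).div (h.tendsto_card_nodeSet i) hi.ne'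
  rw [← mul_add, mul_div_cancel_left₀ _ hi.ne'] at h1
  refine h1.congr' ?_
  filter_upwards [eventually_gt_atTop 0] with m hm
  have hm' : (m : ℝ) ≠ 0 := by exact_mod_cast hm.ne'
  rw [Pi.div_apply, ← add_div, div_div_div_cancel_right₀ hm', countLE_nodeSet (node m) (null m)]
  push_cast
  rfl

theorem tendsto_countLE_univ (h : IsRegular q r₀ ν node null p) (hq : ∑ i, q i = 1) (t : ℚ) :
    Tendsto (fun m : ℕ => (countLE (p m) Finset.univ t : ℝ) /
      ((Finset.univ : Finset (Fin m)).card : ℝ)) atTop (𝓝 ((∑ i, q i * r₀ i) * unif01.real (Set.Iic (t : ℝ)) +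
        (1 - ∑ i, q i * r₀ i) * ν.real (Set.Iic (t : ℝ)))) := by
  have h1 := tendsto_finsetSum Finset.univ
    fun i (_ : i ∈ Finset.univ) => (h.count i true t).add (h.count i false t)
  have heq : ∑ i, (q i * cellWeight ν (r₀ i) true t + q i * cellWeight ν (r₀ i) false t) =
      (∑ i, q i * r₀ i) * unif01.real (Set.Iic (t : ℝ)) +
        (1 - ∑ i, q i * r₀ i) * ν.real (Set.Iic (t : ℝ)) := by
    rw [← hq, ← Finset.sum_sub_distrib, Finset.sum_mul, Finset.sum_mul, ← Finset.sum_add_distrib]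
    refine Finset.sum_congr rfl fun i _ => ?_
    simp only [cellWeight, cond_true, cond_false]
    ring
  rw [heq] at h1
  refine h1.congr fun m => ?_
  rw [countLE_univ (node m) (null m), Finset.card_univ, Fintype.card_fin]
  push_cast
  rw [Finset.sum_div]
  exact Finset.sum_congr rfl fun i _ => (add_div _ _ _).symm

/-- A cell evaluated at thresholds converging to `τ`; the thresholds do not matter in a node with
vanishing weight. -/
theorem tendsto_cellCount_threshold (h : IsRegular q r₀ ν node null p) (hq : ∀ i, 0 ≤ q i)
    {τ : ℝ} (hτ : τ ∈ Set.Ioo (0 : ℝ) 1)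
    (hν : ContinuousAt (fun t => ν.real (Set.Iic t)) τ) {T : ℕ → ℝ} (i : Fin N)
    (hT : 0 < q i → Tendsto T atTop (𝓝 τ)) (b : Bool) :
    Tendsto (fun m : ℕ => (cellCount (node m) (null m) (p m) i b (T m) : ℝ) / m) atTop
      (𝓝 (q i * cellWeight ν (r₀ i) b τ)) := by
  rcases (hq i).eq_or_lt with hi | hi
  · have h0 := h.card i b
    rw [← hi, zero_mul] at h0 ⊢
    refine squeeze_zero (fun m => by positivity) (fun m => ?_) h0
    have := cellCount_le_cellCard (node m) (null m) (p m) i b (T m)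
    gcongr
  · refine tendsto_apply_of_monotone
      (f := fun m t => (cellCount (node m) (null m) (p m) i b t : ℝ) / m)
      (g := fun t => q i * cellWeight ν (r₀ i) b t) (fun m s t hst => ?_) (h.count i b) (hT hi)
      ((continuousAt_cellWeight hτ hν _ _).const_mul _)
    have := cellCount_mono (node m) (null m) (p m) i b hst
    dsimp only
    gcongr

/-- This supplies the premise under which the estimator of a node is consistent. -/
theorem tendsto_card_nodeSet_atTop (h : IsRegular q r₀ ν node null p) {i : Fin N} (hi : 0 < q i) :
    Tendsto (fun m => (nodeSet (node m) i).card) atTop atTop := by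
  rw [← tendsto_natCast_atTop_iff (R := ℝ)]
  refine ((h.tendsto_card_nodeSet i).pos_mul_atTop hi tendsto_natCast_atTop_atTop).congr' ?_
  filter_upwards [eventually_gt_atTop 0] with m hm
  have hm' : (m : ℝ) ≠ 0 := by exact_mod_cast hm.ne'
  rw [div_mul_cancel₀ _ hm']

/-- Consistency is needed only where `q i > 0`: elsewhere the estimate stays in `[0, 1]` and is
multiplied by a vanishing share. -/
theorem tendsto_globalNullEstimate (h : IsRegular q r₀ ν node null p) (hq : ∀ i, 0 ≤ q i)
    {rhat : ℕ → Fin N → ℝ} (hmem : ∀ m i, rhat m i ∈ Set.Icc (0 : ℝ) 1)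
    (hrhat : ∀ i, 0 < q i → Tendsto (fun m => rhat m i) atTop (𝓝 (r₀ i))) :
    Tendsto (fun m => globalNullEstimate (node m) (rhat m)) atTop (𝓝 (∑ i, q i * r₀ i)) := by
  have h1 : ∀ i, Tendsto (fun m : ℕ => rhat m i * (((nodeSet (node m) i).card : ℝ) / m)) atTop
      (𝓝 (q i * r₀ i)) := by
    intro i
    rcases (hq i).eq_or_lt with hi | hi
    · have h0 := h.tendsto_card_nodeSet i
      rw [← hi, zero_mul]
      rw [← hi] at h0
      exact squeeze_zero (fun m => mul_nonneg (hmem m i).1 (by positivity))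
        (fun m => mul_le_of_le_one_left (by positivity) (hmem m i).2) h0
    · rw [mul_comm (q i)]
      exact (hrhat i hi).mul (h.tendsto_card_nodeSet i)
  refine (tendsto_finsetSum Finset.univ fun i _ => h1 i).congr fun m => ?_
  rw [globalNullEstimate, one_div_mul_eq_div, Finset.sum_div]
  exact Finset.sum_congr rfl fun i _ => (mul_div_assoc _ _ _).symm

theorem tendsto_localLevel (h : IsRegular q r₀ ν node null p) (hq : ∀ i, 0 ≤ q i) {α : ℝ}
    (hr : ∀ i, r₀ i ∈ Set.Ico (0 : ℝ) 1) (hlt : ∑ i, q i * r₀ i < 1)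
    (hβ : 1 < slope α (∑ i, q i * r₀ i))
    {rhat : ℕ → Fin N → ℝ} (hmem : ∀ m i, rhat m i ∈ Set.Icc (0 : ℝ) 1)
    (hrhat : ∀ i, 0 < q i → Tendsto (fun m => rhat m i) atTop (𝓝 (r₀ i)))
    {i : Fin N} (hi : 0 < q i) :
    Tendsto (fun m => localLevel α (node m) (rhat m) i) atTop
      (𝓝 (1 / ((1 - r₀ i) * slope α (∑ i, q i * r₀ i) + r₀ i))) := by
  have hg := h.tendsto_globalNullEstimate hq hmem hrhat
  have hs : Tendsto (fun m => slopeEstimate α (node m) (rhat m)) atTop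
      (𝓝 (slope α (∑ i, q i * r₀ i))) :=
    (tendsto_const_nhds.sub hg).div (tendsto_const_nhds.sub hg) (sub_pos.2 hlt).ne'
  refine tendsto_const_nhds.div (((tendsto_const_nhds.sub (hrhat i hi)).mul hs).add (hrhat i hi)) ?_
  have := mul_pos (sub_pos.2 (hr i).2) (zero_lt_one.trans hβ)
  linarith [(hr i).1]

end IsRegular

/-! ### Bounds for the limiting parameters, and almost sure regularity. -/

theorem one_lt_slope {α r : ℝ} (hα : α ∈ Set.Ioo (0 : ℝ) 1) (hr : r < 1) : 1 < slope α r := by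
  have h1 : 1 < 1 / α := (one_lt_div hα.1).2 hα.2
  rw [slope, one_lt_div (sub_pos.2 hr)]
  linarith

theorem sum_mul_mem_Ico {N : ℕ} {q r : Fin N → ℝ} (hq : ∀ i, 0 ≤ q i) (hsum : ∑ i, q i = 1)
    (hr : ∀ i, r i ∈ Set.Ico (0 : ℝ) 1) : ∑ i, q i * r i ∈ Set.Ico (0 : ℝ) 1 := by
  refine ⟨Finset.sum_nonneg fun i _ => mul_nonneg (hq i) (hr i).1, ?_⟩
  obtain ⟨j, -, hj⟩ : ∃ j ∈ Finset.univ, (0 : ℝ) < q j := by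
    by_contra! hcon
    linarith [Finset.sum_nonpos hcon]
  rw [← hsum]
  exact Finset.sum_lt_sum (fun i _ => mul_le_of_le_one_right (hq i) (hr i).2.le)
    ⟨j, Finset.mem_univ j, mul_lt_of_lt_one_right hj (hr j).2⟩

/-- Cutoffs are restricted to the rationals so that only countably many null sets are discarded. -/
theorem ae_isRegular {N : ℕ} {Ω : Type*} [MeasurableSpace Ω] {μ : Measure Ω}
    [IsProbabilityMeasure μ] {r₀ : Fin N → ℝ} (hr₀ : ∀ i, r₀ i ∈ Set.Ico (0 : ℝ) 1)
    {ν : Measure ℝ} [IsProbabilityMeasure ν]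
    {q : ℕ → Fin N → ℝ} (hq_nonneg : ∀ m i, 0 ≤ q m i)
    {qlim : Fin N → ℝ} (hq_lim : ∀ i, Tendsto (fun m => q m i) atTop (𝓝 (qlim i)))
    {scheme : Scheme}
    {node : (m : ℕ) → Ω → Fin m → Fin N} {null : (m : ℕ) → Ω → Fin m → Bool}
    {p : (m : ℕ) → Ω → Fin m → ℝ} (hsample : IsNetworkSample μ scheme q r₀ ν node null p) :
    ∀ᵐ ω ∂μ, IsRegular qlim r₀ ν (fun m => node m ω) (fun m => null m ω) (fun m => p m ω) := by
  classical
  have h1 : ∀ᵐ ω ∂μ, ∀ i b, ∀ t : ℚ, Tendsto (fun m : ℕ =>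
      (cellCount (node m ω) (null m ω) (p m ω) i b t : ℝ) / m) atTop
      (𝓝 (qlim i * cellWeight ν (r₀ i) b t)) := by
    simp only [ae_all_iff]
    intro i b t
    filter_upwards [ae_tendsto_cell_count hr₀ hq_nonneg hq_lim hsample i b
      (measurableSet_Iic (a := (t : ℝ)))] with ω hω
    refine hω.congr fun m => ?_
    simp only [Set.mem_Iic, cellCount]
  have h2 : ∀ᵐ ω ∂μ, ∀ i b, Tendsto (fun m : ℕ =>
      (cellCard (node m ω) (null m ω) i b : ℝ) / m) atTop
      (𝓝 (qlim i * bif b then r₀ i else 1 - r₀ i)) := by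
    simp only [ae_all_iff]
    intro i b
    filter_upwards [ae_tendsto_cell_count hr₀ hq_nonneg hq_lim hsample i b
      MeasurableSet.univ] with ω hω
    simpa only [probReal_univ, mul_one, Set.mem_univ, and_true, cellCard] using hω
  filter_upwards [h1, h2] with ω hω1 hω2
  exact ⟨hω1, hω2⟩

end DistributedBH

/-! ### Comparison of the two procedures. -/

open DistributedBH in
theorem mainTheorem1 {N : ℕ} {Ω : Type*} [MeasurableSpace Ω] (μ : Measure Ω)
    [IsProbabilityMeasure μ]
    -- target level, local null proportions, law of the p-values under the alternative
    (α : ℝ) (hα : α ∈ Set.Ioo (0 : ℝ) 1)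
    (r₀ : Fin N → ℝ) (hr₀ : ∀ i, r₀ i ∈ Set.Ico (0 : ℝ) 1)
    (ν : Measure ℝ) [IsProbabilityMeasure ν] (hν : ν (Set.Icc 0 1) = 1)
    -- node probabilities `q_m → q`
    (q : ℕ → Fin N → ℝ) (hq_nonneg : ∀ m i, 0 ≤ q m i) (hq_sum : ∀ m, ∑ i, q m i = 1)
    (qlim : Fin N → ℝ) (hq_lim : ∀ i, Tendsto (fun m => q m i) atTop (𝓝 (qlim i)))
    (hq_div : ∀ i, ¬ Summable (fun m => q m i))
    -- the p-values
    (scheme : DistributedBH.Scheme)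
    (node : (m : ℕ) → Ω → Fin m → Fin N) (null : (m : ℕ) → Ω → Fin m → Bool)
    (p : (m : ℕ) → Ω → Fin m → ℝ)
    (hsample : DistributedBH.IsNetworkSample μ scheme q r₀ ν node null p)
    -- strongly consistent estimators of the local null proportions
    (rhat : ℕ → Ω → Fin N → ℝ) (hrhat_meas : ∀ m i, Measurable (fun ω => rhat m ω i))
    (hrhat_mem : ∀ m ω i, rhat m ω i ∈ Set.Icc (0 : ℝ) 1)
    (hrhat : ∀ i, ∀ᵐ ω ∂μ,
      Tendsto (fun m => (DistributedBH.nodeSet (node m ω) i).card) atTop atTop →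
        Tendsto (fun m => rhat m ω i) atTop (𝓝 (r₀ i)))
    -- the limiting slope and threshold
    (β τ : ℝ) (hβ : β = DistributedBH.slope α (∑ i, qlim i * r₀ i))
    (hτ : τ = DistributedBH.lastCrossing (fun t => cdf ν t) β)
    (hF : DistributedBH.ContinuouslyDifferentiableAt (fun t => cdf ν t) τ)
    (hF' : deriv (fun t => cdf ν t) τ ≠ β)
    (hτ_pos : 0 < τ) :
    ∃ fdr power : ℝ,
      Tendsto (fun m => ∫ ω, DistributedBH.fdp (null m ω)
        (DistributedBH.globalReject α (p m ω)) ∂μ) atTop (𝓝 fdr) ∧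
      Tendsto (fun m => ∫ ω, DistributedBH.fdp (null m ω)
        (DistributedBH.distReject α (node m ω) (rhat m ω) (p m ω)) ∂μ) atTop (𝓝 fdr) ∧
      Tendsto (fun m => ∫ ω, DistributedBH.tdp (null m ω)
        (DistributedBH.globalReject α (p m ω)) ∂μ) atTop (𝓝 power) ∧
      Tendsto (fun m => ∫ ω, DistributedBH.tdp (null m ω)
        (DistributedBH.distReject α (node m ω) (rhat m ω) (p m ω)) ∂μ) atTop (𝓝 power) := by
  have hqlim_nonneg : ∀ i, 0 ≤ qlim i := fun i => ge_of_tendsto' (hq_lim i) (hq_nonneg · i)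
  have hqlim_sum : ∑ i, qlim i = 1 := by
    refine tendsto_nhds_unique (tendsto_finsetSum Finset.univ fun i _ => hq_lim i) ?_
    simp only [hq_sum, tendsto_const_nhds]
  have hrs := sum_mul_mem_Ico hqlim_nonneg hqlim_sum hr₀
  have hβ1 : 1 < β := hβ ▸ one_lt_slope hα hrs.2
  have hβ0 : 0 < β := zero_lt_one.trans hβ1
  have hFd : DifferentiableAt ℝ (fun t => cdf ν t) τ := hF.1.self_of_nhds
  have hcross : ν.real (Set.Iic τ) = β * τ := by
    rw [← cdf_eq_real, hτ]
    exact cdf_lastCrossing hβ0 (hτ ▸ hτ_pos)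
  have hright : ∀ t, τ < t → ν.real (Set.Iic t) < β * t := fun t ht => by
    rw [← cdf_eq_real]
    exact cdf_lt_of_lastCrossing_lt hβ0 (hτ ▸ ht)
  have hleft : ∀ᶠ t in 𝓝[<] τ, β * t < ν.real (Set.Iic t) := by
    simp only [← cdf_eq_real]
    subst hτ
    exact eventually_lt_cdf_of_deriv_ne hβ0 hτ_pos hFd hF'
  have hνc : ContinuousAt (fun t => ν.real (Set.Iic t)) τ := by
    simp only [← cdf_eq_real]
    exact hFd.continuousAt
  -- `β * τ = F(τ) ≤ 1` with `β > 1`.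
  have hτ1 : τ < 1 := by
    have h1 : β * τ ≤ 1 := hcross ▸ measureReal_le_one
    nlinarith
  have hτI : τ ∈ Set.Ioo (0 : ℝ) 1 := ⟨hτ_pos, hτ1⟩
  -- Inverting the slope formula shows that `α` is the mixture level for the global null proportion,
  -- so global BH falls under the same threshold lemma as the nodes.
  have hαβ : α = 1 / ((1 - ∑ i, qlim i * r₀ i) * β + ∑ i, qlim i * r₀ i) := by
    rw [hβ, DistributedBH.slope, mul_div_cancel₀ _ (sub_pos.2 hrs.2).ne', sub_add_cancel, one_div_one_div]
  have hreg := ae_isRegular hr₀ hq_nonneg hq_lim hsample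
  set L : Bool → ℝ := fun b => ∑ i, qlim i * cellWeight ν (r₀ i) b τ with hL
  have hglobal : ∀ᵐ ω ∂μ, ∀ b, Tendsto (fun m : ℕ =>
      (((globalReject α (p m ω)).filter fun k => null m ω k = b).card : ℝ) / m) atTop
      (𝓝 (L b)) := by
    filter_upwards [hreg] with ω h b
    have hT := tendsto_bhThreshold_mixture hβ1 hrs hτI hright hleft (fun _ => hα.1.le)
      (hαβ ▸ tendsto_const_nhds) (h.tendsto_countLE_univ hqlim_sum)
    refine (tendsto_finsetSum Finset.univ fun i _ =>
      h.tendsto_cellCount_threshold hqlim_nonneg hτI hνc i (fun _ => hT) b).congr fun m => ?_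
    rw [card_filter_globalReject (node m ω), ← Finset.sum_div]
    push_cast
    rfl
  have hdist : ∀ᵐ ω ∂μ, ∀ b, Tendsto (fun m : ℕ =>
      (((distReject α (node m ω) (rhat m ω) (p m ω)).filter fun k => null m ω k = b).card : ℝ) / m)
      atTop (𝓝 (L b)) := by
    filter_upwards [hreg, ae_all_iff.2 hrhat] with ω h hr b
    have hr' : ∀ i, 0 < qlim i → Tendsto (fun m => rhat m ω i) atTop (𝓝 (r₀ i)) :=
      fun i hi => hr i (h.tendsto_card_nodeSet_atTop hi)
    have hT := fun i (hi : 0 < qlim i) => tendsto_bhThreshold_mixture hβ1 (hr₀ i) hτI hright hleft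
      (fun m => localLevel_nonneg hα (node m ω) (hrhat_mem m ω) i)
      (hβ ▸ h.tendsto_localLevel hqlim_nonneg hr₀ hrs.2 (hβ ▸ hβ1) (hrhat_mem · ω) hr' hi)
      (h.tendsto_countLE_nodeSet hi)
    refine (tendsto_finsetSum Finset.univ fun i _ =>
      h.tendsto_cellCount_threshold hqlim_nonneg hτI hνc i (hT i) b).congr fun m => ?_
    rw [card_filter_distReject, ← Finset.sum_div]
    push_cast
    rfl
  -- The limiting proportion of rejections is the pooled distribution function at `τ`; its
  -- alternative part `(1 - r₀*) β τ` is positive, where `r₀* = ∑ i, qlim i * r₀ i`.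
  have hR : 0 < L true + L false := by
    have heq : L true + L false = (∑ i, qlim i * r₀ i) * τ + (1 - ∑ i, qlim i * r₀ i) * (β * τ) := by
      simp only [hL, cellWeight, cond_true, cond_false, hcross,
        unif01_real_Iic_of_mem (Set.Ioo_subset_Icc_self hτI)]
      have hsub : 1 - ∑ i, qlim i * r₀ i = ∑ i, qlim i * (1 - r₀ i) := by
        simp only [mul_sub, mul_one, Finset.sum_sub_distrib, hqlim_sum]
      rw [hsub, Finset.sum_mul, Finset.sum_mul]
      congr 1 <;> exact Finset.sum_congr rfl fun i _ => by ring
    rw [heq]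
    exact add_pos_of_nonneg_of_pos (mul_nonneg hrs.1 hτ_pos.le)
      (mul_pos (sub_pos.2 hrs.2) (mul_pos hβ0 hτ_pos))
  have hM : 0 < ∑ i, qlim i * (1 - r₀ i) := by
    simp only [mul_sub, mul_one, Finset.sum_sub_distrib, hqlim_sum]
    exact sub_pos.2 hrs.2
  -- The limits depend on a procedure only through `L`, which both procedures share.
  have hfinal : ∀ A : (m : ℕ) → Ω → Finset (Fin m), (∀ m j, MeasurableSet {ω | j ∈ A m ω}) →
      (∀ᵐ ω ∂μ, ∀ b, Tendsto (fun m : ℕ =>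
        (((A m ω).filter fun k => null m ω k = b).card : ℝ) / m) atTop (𝓝 (L b))) →
      Tendsto (fun m => ∫ ω, fdp (null m ω) (A m ω) ∂μ) atTop (𝓝 (L true / (L true + L false))) ∧
      Tendsto (fun m => ∫ ω, tdp (null m ω) (A m ω) ∂μ) atTop
        (𝓝 ((L true + L false - L true) / ∑ i, qlim i * (1 - r₀ i))) := by
    intro A hA hlim
    refine tendsto_integral_fdp_tdp hR hM hsample.measurable_null hA
      (hlim.mono fun ω h => h true) (hlim.mono fun ω h => ?_)
      (hreg.mono fun ω h => h.tendsto_card_filter_null)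
    refine ((h true).add (h false)).congr fun m => ?_
    rw [← add_div, ← card_filter_null_add (null m ω) (A m ω)]
    push_cast
    rfl
  obtain ⟨h1, h2⟩ := hfinal (fun m ω => globalReject α (p m ω))
    (fun m => measurableSet_mem_globalReject hα.1.le (hsample.measurable_p m)) hglobal
  obtain ⟨h3, h4⟩ := hfinal (fun m ω => distReject α (node m ω) (rhat m ω) (p m ω))
    (fun m => measurableSet_mem_distReject hα (hsample.measurable_node m) (hrhat_meas m)
      (hrhat_mem m) (hsample.measurable_p m)) hdist
  exact ⟨_, _, h1, h3, h2, h4⟩
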